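/- All groups are finite. Let $A$ be a nilpotent group acting by automorphisms on a solvable group $G$, and let $GA = G\rtimes A$ be the semidirect product. Suppose that * the action is good: $H=[H,B]\,C_H(B)$ for every subgroup $B\le A$ and every $B$-invariant subgroup $H\le G$, where $[H,B]=\langle h^{-1}h^b : h\in H,\ b\in B\rangle$; * $A$ acts with regular orbits on $G$: for every $A$-invariant section $S$ of $G$ on which $A$ acts irreducibly there is $x\in S$ with $C_A(x)=C_A(S)$. Let $V$ be a complex $GA$-module such that $V_G$ is homogeneous (all irreducible $G$-submodules of $V$ are isomorphic), $C_V(A)=0$, and $C_V(A_0)\neq 0$ for every proper subgroup $A_0<A$. Let $N\le G$ be a subgroup that is normal in $GA$ and such that $[Z(N),A]$ acts nontrivially on $V$, and let $W$ be a homogeneous component of $V_N$ (the sum of all irreducible $N$-submodules of $V$ isomorphic to a given one). Then $W$ is $A$-invariant, $[G,A]\le N_G(W)$, and $G=N_G(W)\,C_G(A)$, where $N_G(W)=\{g\in G : gW=W\}$. -/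

import Mathlib

open scoped Pointwise MonoidAlgebra

namespace GoodAction

section Groups

variable {G A : Type*} [Group G] [Group A]

/-- `H ≤ G` is invariant under the subgroup `B` of the group `A` acting on `G` via `φ`. -/
def IsInvariant (φ : A →* MulAut G) (B : Subgroup A) (H : Subgroup G) : Prop :=
  ∀ b ∈ B, ∀ h ∈ H, φ b h ∈ H

/-- The subgroup `[H, B]` of `G` generated by the commutators `[h, b] = h⁻¹ hᵇ`,
for `h ∈ H` and `b ∈ B`. -/
def commSubgroup (φ : A →* MulAut G) (H : Subgroup G) (B : Subgroup A) : Subgroup G :=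
  Subgroup.closure {x | ∃ h ∈ H, ∃ b ∈ B, x = h⁻¹ * φ b h}

/-- The subgroup `C_H(B)` of the elements of `H` fixed by every element of `B`. -/
def fixedSubgroup (φ : A →* MulAut G) (H : Subgroup G) (B : Subgroup A) : Subgroup G where
  carrier := {h | h ∈ H ∧ ∀ b ∈ B, φ b h = h}
  mul_mem' {x y} hx hy :=
    ⟨H.mul_mem hx.1 hy.1, fun b hb => by rw [map_mul, hx.2 b hb, hy.2 b hb]⟩
  one_mem' := ⟨H.one_mem, fun b _ => map_one _⟩
  inv_mem' {x} hx := ⟨H.inv_mem hx.1, fun b hb => by rw [map_inv, hx.2 b hb]⟩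

/-- The action of `A` on `G` is good: `H = [H, B] C_H(B)` (product of subsets) for every
subgroup `B` of `A` and every `B`-invariant subgroup `H` of `G`. -/
def IsGood (φ : A →* MulAut G) : Prop :=
  ∀ (B : Subgroup A) (H : Subgroup G), IsInvariant φ B H →
    (H : Set G) = (commSubgroup φ H B : Set G) * (fixedSubgroup φ H B : Set G)

/-- `H / K` is an `A`-invariant section of `G` on which `A` acts irreducibly: `K ≤ H` are
`A`-invariant subgroups, `K` is normal in `H` and proper, and no `A`-invariant subgroup lies
strictly between `K` and `H`. -/
structure IsIrreducibleSection (φ : A →* MulAut G) (H K : Subgroup G) : Prop where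
  invariant_top : IsInvariant φ ⊤ H
  invariant_bot : IsInvariant φ ⊤ K
  lt : K < H
  normal : ∀ h ∈ H, ∀ k ∈ K, h * k * h⁻¹ ∈ K
  irreducible : ∀ L : Subgroup G, IsInvariant φ ⊤ L → K ≤ L → L ≤ H → L = K ∨ L = H

/-- `A` acts with regular orbits on `G`: for every `A`-invariant section `S = H / K` of `G` on
which `A` acts irreducibly there is `xK ∈ S` with `C_A(xK) = C_A(S)`. -/
def HasRegularOrbits (φ : A →* MulAut G) : Prop :=
  ∀ H K : Subgroup G, IsIrreducibleSection φ H K →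
    ∃ x ∈ H, {a : A | x⁻¹ * φ a x ∈ K} = {a : A | ∀ h ∈ H, h⁻¹ * φ a h ∈ K}

end Groups

section Modules

variable {Γ V : Type*} [Group Γ] [AddCommGroup V] [Module ℂ V]

/-- The module afforded by `σ` is homogeneous: all its irreducible submodules are isomorphic
(over a finite group it is then a direct sum of copies of one irreducible module). -/
def IsHomogeneous (σ : Representation ℂ Γ V) : Prop :=
  IsIsotypic ℂ[Γ] σ.asModule

/-- The subspace `W` is a homogeneous component of the module afforded by `σ`: the sum of all
submodules isomorphic to a given irreducible submodule. -/
def IsHomogeneousComponent (σ : Representation ℂ Γ V) (W : Submodule ℂ V) : Prop :=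
  ∃ U : Subrepresentation σ, U.toSubmodule = W ∧
    U.asSubmodule ∈ isotypicComponents ℂ[Γ] σ.asModule

/-- The setwise stabilizer `N_Γ(W)` of a subspace `W` of a `Γ`-module. -/
def stabilizer (σ : Representation ℂ Γ V) (W : Submodule ℂ V) : Subgroup Γ where
  carrier := {g | W.map (σ g) = W}
  mul_mem' {x y} hx hy := by
    change W.map (σ (x * y)) = W
    rw [map_mul, Module.End.mul_eq_comp, Submodule.map_comp, show W.map (σ y) = W from hy,
      show W.map (σ x) = W from hx]
  one_mem' := by
    change W.map (σ 1) = W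
    rw [map_one, Module.End.one_eq_id, Submodule.map_id]
  inv_mem' {x} hx := by
    change W.map (σ x⁻¹) = W
    conv_lhs => rw [← show W.map (σ x) = W from hx]
    rw [← Submodule.map_comp, ← Module.End.mul_eq_comp, ← map_mul, inv_mul_cancel, map_one,
      Module.End.one_eq_id, Submodule.map_id]

end Modules

end GoodAction

/-! Let `Δ` be the set of homogeneous components of `V_N`. The group `GA` permutes `Δ`, by
Clifford's theorem `G` is transitive on it, and `V` is the direct sum of its members. Everything
follows once `A` fixes every point of `Δ`: then `[G, A]` acts trivially on `Δ`, and since `G = [G,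
A] C_G(A)`, already `C_G(A)` is transitive.

Fixed points of `A` in `V` are read off from `Δ` by averaging. If `C_V(B) ≠ 0`, some component
contains a nonzero vector fixed by its stabilizer in `B`; for `B = A` no component does, as `C_V(A)
= 0`. Suppose some `ω` in `Δ` has a stabilizer `B` in `A` that fixes all of `Δ`. If `B < A`, some
component has a vector fixed by `B`; goodness makes `C_G(B)` transitive, so this vector moves into
`ω`, where it contradicts `C_V(A) = 0`. Hence `B = A` (`act_eq_of_stabilizer_eq_kernel`).

Such an `ω` need not be visible for `G` itself. An induction on orbits of invariant subgroups
(`IsStableOrbit.act_eq`) passes to block systems and to single blocks until the acting group is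
abelian and `A`-irreducible modulo its kernel. There `exists_stabilizer_eq_kernel` identifies `Δ`
with an irreducible section of `G`, unless `A` centralizes that section, and the regular orbit
provides `ω`. -/

namespace GoodAction

/-- In a nilpotent group, a nontrivial normal section `C / R` contains nontrivial central
elements. -/
theorem exists_central_mod {A : Type*} [Group A] [Group.IsNilpotent A] {R C : Subgroup A}
    (hC : C.Normal) (h : ¬ C ≤ R) :
    ∃ c ∈ C, c ∉ R ∧ ∀ a, c * a * c⁻¹ * a⁻¹ ∈ R := by
  classical
  have hex : ∃ n, ¬ C ⊓ Subgroup.upperCentralSeries A n ≤ R := by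
    obtain ⟨n, hn⟩ := Group.IsNilpotent.nilpotent A
    exact ⟨n, by rwa [hn, inf_top_eq]⟩
  -- An element of `C` outside `R` taken from the lowest possible term of the upper central series
  -- has all its commutators in `C` and one term lower, hence in `R`.
  obtain ⟨m, hm, hmin⟩ : ∃ m, (¬ C ⊓ Subgroup.upperCentralSeries A m ≤ R) ∧
      ∀ k < m, C ⊓ Subgroup.upperCentralSeries A k ≤ R :=
    ⟨Nat.find hex, Nat.find_spec hex, fun k hk => not_not.1 (Nat.find_min hex hk)⟩
  obtain ⟨c, hc, hcR⟩ := SetLike.not_le_iff_exists.1 hm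
  refine ⟨c, hc.1, hcR, fun a => ?_⟩
  cases m with
  | zero =>
    have : c = 1 := by simpa using hc.2
    exact absurd (this ▸ R.one_mem) hcR
  | succ k =>
    refine hmin k (Nat.lt_succ_self k) ⟨?_, Subgroup.mem_upperCentralSeries_succ_iff.1 hc.2 a⟩
    rw [mul_assoc, mul_assoc, ← mul_assoc a]
    exact C.mul_mem hc.1 (hC.conj_mem _ (C.inv_mem hc.1) a)

/-! ### Stable orbits, and the regular orbit in the abelian irreducible case -/

section Orbits

variable {G A Ω : Type*} [Group G] [Group A] [MulAction G Ω] [MulAction A Ω]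

/-- `Δ` is an orbit of the `A`-invariant subgroup `H` of `G` under compatible actions of `G` and
`A`, and it is stable under `A`. -/
structure IsStableOrbit (φ : A →* MulAut G) (H : Subgroup G) (Δ : Set Ω) : Prop where
  compat : ∀ (a : A) (g : G) (ω : Ω), a • g • ω = φ a g • a • ω
  invariant : ∀ (a : A), ∀ h ∈ H, φ a h ∈ H
  smul_mem : ∀ h ∈ H, ∀ ω ∈ Δ, h • ω ∈ Δ
  act_mem : ∀ (a : A), ∀ ω ∈ Δ, a • ω ∈ Δ
  trans : ∀ ω ∈ Δ, ∀ ω' ∈ Δ, ∃ h ∈ H, h • ω = ω'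

variable {φ : A →* MulAut G} {H : Subgroup G} {Δ : Set Ω}

namespace IsStableOrbit

theorem aut_smul (hΔ : IsStableOrbit φ H Δ) (a : A) (g : G) (ω : Ω) :
    φ a g • ω = a • g • a⁻¹ • ω := by
  rw [hΔ.compat, smul_inv_smul]

/-- On `Δ`, twisting `h` by `b` amounts to conjugating by the permutation `b`, which is trivial; so
`h` and `φ b h` induce the same permutation. -/
theorem commSubgroup_smul (hΔ : IsStableOrbit φ H Δ) {B : Subgroup A}
    (hB : ∀ b ∈ B, ∀ ω ∈ Δ, b • ω = ω) :
    ∀ x ∈ commSubgroup φ H B, ∀ ω ∈ Δ, x • ω = ω := by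
  intro x hx
  induction hx using Subgroup.closure_induction with
  | mem x hx =>
    obtain ⟨h, hh, b, hb, rfl⟩ := hx
    intro ω hω
    have := hΔ.compat b h ω
    rw [hB b hb _ (hΔ.smul_mem h hh ω hω), hB b hb ω hω] at this
    rw [mul_smul, ← this, inv_smul_smul]
  | one => intro ω _; exact one_smul G ω
  | mul x y _ _ hx hy => intro ω hω; rw [mul_smul, hy ω hω, hx ω hω]
  | inv x _ hx => intro ω hω; rw [inv_smul_eq_iff, hx ω hω]

/-- If the subgroup `B` of `A` fixes every point of an orbit of `H`, and the action is good, then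
`C_H(B)` is transitive on this orbit. -/
theorem exists_fixed_smul_eq (hΔ : IsStableOrbit φ H Δ) (hgood : IsGood φ) {B : Subgroup A}
    (hB : ∀ b ∈ B, ∀ ω ∈ Δ, b • ω = ω) {ω ω' : Ω} (hω : ω ∈ Δ) (hω' : ω' ∈ Δ) :
    ∃ c ∈ fixedSubgroup φ H B, c • ω = ω' := by
  obtain ⟨h, hh, rfl⟩ := hΔ.trans ω hω ω' hω'
  have hh' : h ∈ (commSubgroup φ H B : Set G) * (fixedSubgroup φ H B : Set G) := by
    rw [← hgood B H fun b _ h hh => hΔ.invariant b h hh]; exact hh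
  obtain ⟨u, hu, c, hc, rfl⟩ := Set.mem_mul.1 hh'
  refine ⟨c, hc, ?_⟩
  rw [mul_smul, hΔ.commSubgroup_smul hB u hu _ (hΔ.smul_mem c hc.1 ω hω)]

variable (H Δ) in
/-- The kernel of the action of `H` on the subset `Δ`. -/
def _root_.GoodAction.actionKernel : Subgroup G where
  carrier := {h | h ∈ H ∧ ∀ ω ∈ Δ, h • ω = ω}
  mul_mem' {x y} hx hy :=
    ⟨H.mul_mem hx.1 hy.1, fun ω hω => by rw [mul_smul, hy.2 ω hω, hx.2 ω hω]⟩
  one_mem' := ⟨H.one_mem, fun ω _ => one_smul G ω⟩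
  inv_mem' {x} hx := ⟨H.inv_mem hx.1, fun ω hω => by rw [inv_smul_eq_iff, hx.2 ω hω]⟩

theorem actionKernel_invariant (hΔ : IsStableOrbit φ H Δ) (a : A) :
    ∀ h ∈ actionKernel H Δ, φ a h ∈ actionKernel H Δ := fun h hh =>
  ⟨hΔ.invariant a h hh.1, fun ω hω => by
    rw [hΔ.aut_smul, hh.2 _ (hΔ.act_mem a⁻¹ ω hω), smul_inv_smul]⟩

theorem actionKernel_normal (hΔ : IsStableOrbit φ H Δ) :
    ∀ h ∈ H, ∀ k ∈ actionKernel H Δ, h * k * h⁻¹ ∈ actionKernel H Δ := fun h hh k hk =>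
  ⟨H.mul_mem (H.mul_mem hh hk.1) (H.inv_mem hh), fun ω hω => by
    rw [mul_smul, mul_smul, hk.2 _ (hΔ.smul_mem _ (H.inv_mem hh) ω hω), smul_inv_smul]⟩

/-- The elements of `H` on whose images in the permutation group of `Δ` the set `S` acts
trivially. -/
def centralizerMod (hΔ : IsStableOrbit φ H Δ) (S : Set A) : Subgroup G where
  carrier := {h | h ∈ H ∧ ∀ s ∈ S, ∀ ω ∈ Δ, φ s h • ω = h • ω}
  mul_mem' {x y} hx hy :=
    ⟨H.mul_mem hx.1 hy.1, fun s hs ω hω => by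
      rw [map_mul, mul_smul, hy.2 s hs ω hω, hx.2 s hs _ (hΔ.smul_mem y hy.1 ω hω), mul_smul]⟩
  one_mem' := ⟨H.one_mem, fun s _ ω _ => by rw [map_one]⟩
  inv_mem' {x} hx := ⟨H.inv_mem hx.1, fun s hs ω hω => by
    rw [map_inv, inv_smul_eq_iff, hx.2 s hs _ (hΔ.smul_mem _ (H.inv_mem hx.1) ω hω),
      smul_inv_smul]⟩

theorem actionKernel_le_centralizerMod (hΔ : IsStableOrbit φ H Δ) (S : Set A) :
    actionKernel H Δ ≤ hΔ.centralizerMod S := fun h hh =>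
  ⟨hh.1, fun s _ ω hω => by rw [(hΔ.actionKernel_invariant s h hh).2 ω hω, hh.2 ω hω]⟩

/-- A transitive abelian permutation group is regular. Thus `Δ` is a torsor under `H` modulo its
kernel. -/
theorem mem_actionKernel_of_smul_eq (hΔ : IsStableOrbit φ H Δ)
    (hcomm : ∀ h ∈ H, ∀ k ∈ H, ∀ ω ∈ Δ, h • k • ω = k • h • ω) {h : G} (hh : h ∈ H) {ω : Ω}
    (hω : ω ∈ Δ) (hfix : h • ω = ω) : h ∈ actionKernel H Δ := by
  refine ⟨hh, fun ω' hω' => ?_⟩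
  obtain ⟨k, hk, rfl⟩ := hΔ.trans ω hω ω' hω'
  rw [hcomm h hh k hk ω hω, hfix]

/-- Suppose that `H` induces on `Δ` an abelian group on which the nilpotent group `A` acts
irreducibly. If that action has a regular orbit, then so does the action on `Δ`, modulo its
kernel. -/
theorem exists_stabilizer_eq_kernel [Finite G] [Group.IsNilpotent A] (hΔ : IsStableOrbit φ H Δ)
    (hreg : HasRegularOrbits φ) (hne : Δ.Nonempty)
    (hcomm : ∀ h ∈ H, ∀ k ∈ H, ∀ ω ∈ Δ, h • k • ω = k • h • ω)
    (hirr : ∀ J : Subgroup G, IsInvariant φ ⊤ J → actionKernel H Δ ≤ J → J ≤ H →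
      J = actionKernel H Δ ∨ J = H)
    (hlt : ¬ H ≤ actionKernel H Δ) :
    ∃ ω ∈ Δ, ∀ a : A, a • ω = ω → ∀ ω' ∈ Δ, a • ω' = ω' := by
  -- `K` is the kernel of `A` on `Δ`, and `C` the kernel of `A` on the permutation group induced by
  -- `H`. The cases are `C = ⊤`, where one point stabilizer fixes everything, then `C ≤ K`, and `C`
  -- not contained in `K`.
  let K : Subgroup A :=
    { carrier := {a | ∀ ω ∈ Δ, a • ω = ω}
      mul_mem' := fun {x y} hx hy ω hω => by rw [mul_smul, hy ω hω, hx ω hω]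
      one_mem' := fun ω _ => one_smul A ω
      inv_mem' := fun {x} hx ω hω => by rw [inv_smul_eq_iff, hx ω hω] }
  let C : Subgroup A :=
    { carrier := {a | ∀ h ∈ H, ∀ ω ∈ Δ, φ a h • ω = h • ω}
      mul_mem' := fun {x y} hx hy h hh ω hω => by
        rw [map_mul, MulAut.mul_apply, hx _ (hΔ.invariant y h hh) ω hω, hy h hh ω hω]
      one_mem' := fun h _ ω _ => by rw [map_one, MulAut.one_apply]
      inv_mem' := fun {x} hx h hh ω hω => by
        rw [← hx _ (hΔ.invariant x⁻¹ h hh) ω hω, ← MulAut.mul_apply, ← map_mul, mul_inv_cancel,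
          map_one, MulAut.one_apply] }
  have hCn : C.Normal := ⟨fun c hc a h hh ω hω => by
    have h1 : φ (a * c * a⁻¹) h = φ a (φ c (φ a⁻¹ h)) := by simp only [map_mul, MulAut.mul_apply]
    rw [h1, hΔ.aut_smul, hc _ (hΔ.invariant _ h hh) _ (hΔ.act_mem _ ω hω), ← hΔ.aut_smul,
      ← MulAut.mul_apply, ← map_mul, mul_inv_cancel, map_one, MulAut.one_apply]⟩
  obtain ⟨ω₀, hω₀⟩ := hne
  have hCtop (hC : C = ⊤) (a : A) (ha : a • ω₀ = ω₀) : ∀ ω' ∈ Δ, a • ω' = ω' := by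
    intro ω' hω'
    obtain ⟨h, hh, rfl⟩ := hΔ.trans ω₀ hω₀ ω' hω'
    rw [hΔ.compat, ha, (hC ▸ Subgroup.mem_top a : a ∈ C) h hh ω₀ hω₀]
  by_cases hC : C = ⊤
  · exact ⟨ω₀, hω₀, hCtop hC⟩
  by_cases hCK : C ≤ K
  -- As `z` is central modulo `C`, its fixed points in `H / actionKernel H Δ` form an `A`-invariant
  -- subgroup. It is proper because `z` is not in `C`, hence trivial by irreducibility.
  · obtain ⟨z, -, hzC, hz⟩ := exists_central_mod (A := A) (R := C) (C := ⊤) inferInstance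
      (fun h => hC (top_le_iff.1 h))
    have hJ : hΔ.centralizerMod {z} = actionKernel H Δ := by
      refine (hirr _ ?_ (hΔ.actionKernel_le_centralizerMod _) fun h hh => hh.1).resolve_right ?_
      · intro a _ h hh
        refine ⟨hΔ.invariant a h hh.1, ?_⟩
        intro s hs ω hω
        rw [Set.mem_singleton_iff.1 hs]
        have e : φ z (φ a h) = φ (z * a * z⁻¹ * a⁻¹) (φ a (φ z h)) := by
          simp only [← MulAut.mul_apply, ← map_mul]; congr 2; group
        rw [e, hz a _ (hΔ.invariant a _ (hΔ.invariant z h hh.1)) ω hω, hΔ.aut_smul,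
          hh.2 z rfl _ (hΔ.act_mem _ ω hω), ← hΔ.aut_smul]
      · intro hJ
        exact hzC fun h hh ω hω => (hJ.ge hh).2 z rfl ω hω
    have huniq : ∀ h ∈ H, ∀ ω ∈ Δ, φ z h • ω = h • ω → h ∈ actionKernel H Δ := by
      intro h hh ω hω e
      rw [← hJ]
      refine ⟨hh, ?_⟩
      intro s hs ω' hω'
      rw [Set.mem_singleton_iff.1 hs]
      have : h⁻¹ * φ z h ∈ actionKernel H Δ :=
        hΔ.mem_actionKernel_of_smul_eq hcomm (H.mul_mem (H.inv_mem hh) (hΔ.invariant z h hh)) hω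
          (by rw [mul_smul, e, inv_smul_smul])
      have := this.2 ω' hω'
      rwa [mul_smul, inv_smul_eq_iff] at this
    -- `z` fixes at most one point
    have hz1 : ∀ ω ∈ Δ, ∀ ω' ∈ Δ, z • ω = ω → z • ω' = ω' → ω' = ω := by
      intro ω hω ω' hω' h1 h2
      obtain ⟨h, hh, rfl⟩ := hΔ.trans ω hω ω' hω'
      rw [hΔ.compat, h1] at h2
      exact (huniq h hh ω hω h2).2 ω hω
    -- `z` fixes at least one point
    have hz2 : ∃ ω ∈ Δ, z • ω = ω := by
      choose k hk hkω using fun ω : Δ => hΔ.trans ω₀ hω₀ ω.1 ω.2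
      have hmem (ω : Δ) : (k ω)⁻¹ * φ z (k ω) ∈ H :=
        H.mul_mem (H.inv_mem (hk ω)) (hΔ.invariant z _ (hk ω))
      -- With `Δ` parametrized by `k ω • ω₀ = ω`, this is the map `h ↦ h⁻¹ * φ z h` on the section.
      -- It is injective because `z` has no nontrivial fixed points there, so by finiteness it is
      -- onto. If `t • z • ω₀ = ω₀`, a preimage of `t • ω₀` is a fixed point of `z`.
      let f : Δ → Δ := fun ω => ⟨((k ω)⁻¹ * φ z (k ω)) • ω₀, hΔ.smul_mem _ (hmem ω) ω₀ hω₀⟩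
      have hfin : Finite Δ := by
        refine Finite.of_injective k fun x y hxy => Subtype.ext ?_
        rw [← hkω x, ← hkω y, hxy]
      have hf : Function.Injective f := by
        intro x y hxy
        have hxy : ((k x)⁻¹ * φ z (k x)) • ω₀ = ((k y)⁻¹ * φ z (k y)) • ω₀ :=
          congrArg Subtype.val hxy
        have hyx : k y * (k x)⁻¹ ∈ H := H.mul_mem (hk y) (H.inv_mem (hk x))
        have hxinv := H.inv_mem (hk x)
        have key : φ z (k y * (k x)⁻¹) • φ z (k x) • ω₀ = (k y * (k x)⁻¹) • φ z (k x) • ω₀ := by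
          rw [mul_smul, mul_smul, inv_smul_eq_iff] at hxy
          have hm : (k y)⁻¹ • φ z (k y) • ω₀ ∈ Δ := hΔ.smul_mem _ (H.inv_mem (hk y)) _
            (hΔ.smul_mem _ (hΔ.invariant z _ (hk y)) _ hω₀)
          calc φ z (k y * (k x)⁻¹) • φ z (k x) • ω₀ = φ z (k y) • ω₀ := by
                rw [map_mul, map_inv, mul_smul, inv_smul_smul]
            _ = (k y * (k x)⁻¹) • φ z (k x) • ω₀ := by
                rw [hxy, mul_smul, inv_smul_smul, smul_inv_smul]
        have := (huniq _ hyx _ (hΔ.smul_mem _ (hΔ.invariant z _ (hk x)) ω₀ hω₀) key).2 x x.2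
        refine Subtype.ext ?_
        rw [← this, mul_smul, ← hkω x, inv_smul_smul, hkω y]
      obtain ⟨t, ht, hzt⟩ := hΔ.trans _ (hΔ.act_mem z ω₀ hω₀) ω₀ hω₀
      obtain ⟨ω, hω⟩ := Finite.surjective_of_injective hf ⟨t • ω₀, hΔ.smul_mem t ht ω₀ hω₀⟩
      have hω : ((k ω)⁻¹ * φ z (k ω)) • ω₀ = t • ω₀ := congrArg Subtype.val hω
      refine ⟨ω, ω.2, ?_⟩
      rw [mul_smul, inv_smul_eq_iff] at hω
      have h1 : z • ω₀ = t⁻¹ • ω₀ := by rw [eq_inv_smul_iff, hzt]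
      have htinv : t⁻¹ • ω₀ ∈ Δ := hΔ.smul_mem _ (H.inv_mem ht) _ hω₀
      rw [← hkω ω, hΔ.compat, h1,
        hcomm _ (hΔ.invariant z _ (hk ω)) _ (H.inv_mem ht) _ hω₀, hω,
        ← hcomm _ (hk ω) _ (H.inv_mem ht) _ (hΔ.smul_mem t ht _ hω₀), inv_smul_smul]
    obtain ⟨ω₁, hω₁, hzω₁⟩ := hz2
    -- Since `C ≤ K`, `z` commutes with `A` on `Δ`, so `A` preserves the unique fixed point of `z`.
    -- With `ω₁` as origin, `Δ` and the section are isomorphic `A`-sets.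
    have hA : ∀ a : A, a • ω₁ = ω₁ := by
      intro a
      refine hz1 ω₁ hω₁ _ (hΔ.act_mem a ω₁ hω₁) hzω₁ ?_
      have h1 := hCK (hz a) (a • z • ω₁) (hΔ.act_mem a _ (hΔ.act_mem z _ hω₁))
      have h2 : (z * a * z⁻¹ * a⁻¹) • a • z • ω₁ = z • a • ω₁ := by
        simp only [← mul_smul]; congr 1; group
      rw [← h2, h1, hzω₁]
    obtain ⟨x, hx, hxC⟩ := hreg H (actionKernel H Δ)
      { invariant_top := fun a _ => hΔ.invariant a
        invariant_bot := fun a _ => hΔ.actionKernel_invariant a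
        lt := lt_of_le_not_ge (fun h hh => hh.1) hlt
        normal := hΔ.actionKernel_normal
        irreducible := hirr }
    refine ⟨x • ω₁, hΔ.smul_mem x hx ω₁ hω₁, fun a ha => hCK ?_⟩
    rw [hΔ.compat, hA a] at ha
    have hax : x⁻¹ * φ a x ∈ actionKernel H Δ :=
      hΔ.mem_actionKernel_of_smul_eq hcomm (H.mul_mem (H.inv_mem hx) (hΔ.invariant a x hx)) hω₁
        (by rw [mul_smul, ha, inv_smul_smul])
    have ha' : a ∈ {a : A | ∀ h ∈ H, h⁻¹ * φ a h ∈ actionKernel H Δ} := hxC ▸ hax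
    intro h hh ω hω
    have := (ha' h hh).2 ω hω
    rwa [mul_smul, inv_smul_eq_iff] at this
  -- Commuting with a transitive abelian group, `c` acts on `Δ` as some `t` in `H`. Centrality of
  -- `c` modulo `K` makes `t` a nontrivial fixed point of `A` in the section, so by irreducibility
  -- `A` centralizes the section, against `C ≠ ⊤`.
  · obtain ⟨c, hc, hcK, hcz⟩ := exists_central_mod hCn hCK
    obtain ⟨t, ht, htω₀⟩ := hΔ.trans ω₀ hω₀ _ (hΔ.act_mem c ω₀ hω₀)
    have htc : ∀ ω ∈ Δ, t • ω = c • ω := by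
      intro ω hω
      obtain ⟨h, hh, rfl⟩ := hΔ.trans ω₀ hω₀ ω hω
      rw [hΔ.compat, hc h hh _ (hΔ.act_mem c _ hω₀), ← htω₀, hcomm h hh t ht _ hω₀]
    have htJ : t ∈ hΔ.centralizerMod Set.univ := by
      refine ⟨ht, fun a _ ω hω => ?_⟩
      rw [hΔ.aut_smul, htc _ (hΔ.act_mem _ _ hω), htc _ hω]
      have h1 := hcz a (a • c • a⁻¹ • ω) (hΔ.act_mem _ _ (hΔ.act_mem _ _ (hΔ.act_mem _ _ hω)))
      rw [← h1]
      simp only [← mul_smul]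
      congr 1
      group
    have hJ : hΔ.centralizerMod Set.univ = H := by
      refine (hirr _ ?_ (hΔ.actionKernel_le_centralizerMod _) fun h hh => hh.1).resolve_left ?_
      · intro a _ h hh
        refine ⟨hΔ.invariant a h hh.1, fun s _ ω hω => ?_⟩
        rw [← MulAut.mul_apply, ← map_mul, hh.2 _ trivial ω hω, hh.2 _ trivial ω hω]
      · intro hJ
        exact hcK fun ω hω => by rw [← htc ω hω, (hJ ▸ htJ : t ∈ actionKernel H Δ).2 ω hω]
    refine absurd (top_le_iff.1 fun a _ => ?_) hC
    exact fun h hh ω hω => (hJ.ge hh).2 a trivial ω hω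

end IsStableOrbit

end Orbits

open scoped commutatorElement

/-! ### Induction over orbits and block systems -/

section Orbits

universe u v w

variable {G : Type u} {A : Type v} {Ω : Type w} [Group G] [Group A] [MulAction G Ω]
  [MulAction A Ω]

/-- `P ω B` abstracts the property that the stabilizer of `ω` in `B ≤ A` has nonzero fixed points
in the summand indexed by `ω` of a module graded by `Δ`. The last two fields say that `A` has no
nonzero fixed points in the module, while every proper subgroup of `A` does. -/
structure IsMinimallyFixedPointFree (φ : A →* MulAut G) (H : Subgroup G) (Δ : Set Ω)
    (P : Ω → Subgroup A → Prop) : Prop where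
  inf_stabilizer : ∀ ω ∈ Δ, ∀ B, P ω (B ⊓ MulAction.stabilizer A ω) ↔ P ω B
  smul : ∀ ω ∈ Δ, ∀ B, ∀ c ∈ fixedSubgroup φ H B, P ω B → P (c • ω) B
  not_top : ∀ ω ∈ Δ, ¬ P ω ⊤
  exists_of_lt : ∀ B < ⊤, ∃ ω ∈ Δ, P ω B

variable {φ : A →* MulAut G} {H : Subgroup G} {Δ : Set Ω} {P : Ω → Subgroup A → Prop}

/-- Were the stabilizer of `ω` proper, `P` would hold for it at some point, and at `ω` too because
its centralizer in `H` is transitive. But at `ω` it cannot be told apart from `⊤`. -/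
theorem IsMinimallyFixedPointFree.act_eq_of_stabilizer_eq_kernel
    (hP : IsMinimallyFixedPointFree φ H Δ P) (hΔ : IsStableOrbit φ H Δ) (hgood : IsGood φ)
    {ω : Ω} (hω : ω ∈ Δ) (hstab : ∀ a : A, a • ω = ω → ∀ ω' ∈ Δ, a • ω' = ω') :
    ∀ a : A, ∀ ω' ∈ Δ, a • ω' = ω' := by
  by_contra hne
  have hlt : MulAction.stabilizer A ω < ⊤ := by
    refine lt_top_iff_ne_top.2 fun h => hne fun a => hstab a ?_
    exact MulAction.mem_stabilizer_iff.1 (h.ge (Subgroup.mem_top a))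
  obtain ⟨ω', hω', hPω'⟩ := hP.exists_of_lt _ hlt
  obtain ⟨c, hc, rfl⟩ := hΔ.exists_fixed_smul_eq hgood
    (B := MulAction.stabilizer A ω) (fun b hb => hstab b hb) hω' hω
  have := hP.smul ω' hω' _ c hc hPω'
  rw [← top_inf_eq (MulAction.stabilizer A (c • ω')), hP.inf_stabilizer _ hω] at this
  exact hP.not_top _ hω this

/-- The orbit of a point under a subgroup of `G`. -/
def subgroupOrbit (M : Subgroup G) (ω : Ω) : Set Ω := {x | ∃ m ∈ M, m • ω = x}

theorem mem_subgroupOrbit_self (M : Subgroup G) (ω : Ω) : ω ∈ subgroupOrbit M ω :=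
  ⟨1, M.one_mem, one_smul G ω⟩

theorem subgroupOrbit_eq_of_mem {M : Subgroup G} {ω ω' : Ω} (h : ω' ∈ subgroupOrbit M ω) :
    subgroupOrbit M ω' = subgroupOrbit M ω := by
  obtain ⟨m, hm, rfl⟩ := h
  ext x
  constructor
  · rintro ⟨k, hk, rfl⟩
    exact ⟨k * m, M.mul_mem hk hm, mul_smul k m ω⟩
  · rintro ⟨k, hk, rfl⟩
    exact ⟨k * m⁻¹, M.mul_mem hk (M.inv_mem hm), by rw [mul_smul, inv_smul_smul]⟩

namespace IsStableOrbit

variable {M : Subgroup G}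

theorem smul_subgroupOrbit (hn : ∀ h ∈ H, ∀ m ∈ M, h * m * h⁻¹ ∈ M) {h : G} (hh : h ∈ H) (ω : Ω) :
    h • subgroupOrbit M ω = subgroupOrbit M (h • ω) := by
  ext x
  rw [Set.mem_smul_set]
  constructor
  · rintro ⟨_, ⟨m, hm, rfl⟩, rfl⟩
    exact ⟨h * m * h⁻¹, hn h hh m hm, by rw [mul_smul, mul_smul, inv_smul_smul]⟩
  · rintro ⟨m, hm, rfl⟩
    have := hn h⁻¹ (H.inv_mem hh) m hm
    rw [inv_inv] at this
    exact ⟨_, ⟨_, this, rfl⟩, by rw [mul_smul, mul_smul, smul_inv_smul]⟩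

theorem act_subgroupOrbit (hΔ : IsStableOrbit φ H Δ) (hinv : ∀ a : A, ∀ m ∈ M, φ a m ∈ M)
    (a : A) (ω : Ω) : a • subgroupOrbit M ω = subgroupOrbit M (a • ω) := by
  ext x
  rw [Set.mem_smul_set]
  constructor
  · rintro ⟨_, ⟨m, hm, rfl⟩, rfl⟩
    exact ⟨φ a m, hinv a m hm, (hΔ.compat a m ω).symm⟩
  · rintro ⟨m, hm, rfl⟩
    refine ⟨_, ⟨φ a⁻¹ m, hinv a⁻¹ m hm, rfl⟩, ?_⟩
    rw [hΔ.compat, ← MulAut.mul_apply, ← map_mul, mul_inv_cancel, map_one, MulAut.one_apply]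

theorem image_subgroupOrbit (hΔ : IsStableOrbit φ H Δ) (hinv : ∀ a : A, ∀ m ∈ M, φ a m ∈ M)
    (hn : ∀ h ∈ H, ∀ m ∈ M, h * m * h⁻¹ ∈ M) :
    IsStableOrbit φ H (subgroupOrbit M '' Δ) where
  compat a g s := by
    ext x
    simp only [Set.mem_smul_set, exists_exists_and_eq_and, hΔ.compat]
  invariant := hΔ.invariant
  smul_mem := by
    rintro h hh _ ⟨ω, hω, rfl⟩
    exact ⟨h • ω, hΔ.smul_mem h hh ω hω, (smul_subgroupOrbit hn hh ω).symm⟩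
  act_mem := by
    rintro a _ ⟨ω, hω, rfl⟩
    exact ⟨a • ω, hΔ.act_mem a ω hω, (hΔ.act_subgroupOrbit hinv a ω).symm⟩
  trans := by
    rintro _ ⟨ω, hω, rfl⟩ _ ⟨ω', hω', rfl⟩
    obtain ⟨h, hh, rfl⟩ := hΔ.trans ω hω ω' hω'
    exact ⟨h, hh, smul_subgroupOrbit hn hh ω⟩

end IsStableOrbit

/-- A block has the property when one of its points does. Intersecting with the block stabilizer is
harmless, since it contains the stabilizer of each point of the block. -/
theorem IsMinimallyFixedPointFree.image_subgroupOrbit {M : Subgroup G}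
    (hP : IsMinimallyFixedPointFree φ H Δ P) (hΔ : IsStableOrbit φ H Δ) (hMH : M ≤ H)
    (hinv : ∀ a : A, ∀ m ∈ M, φ a m ∈ M) :
    IsMinimallyFixedPointFree φ H (subgroupOrbit M '' Δ) (fun E B => ∃ ω ∈ E, P ω B) where
  inf_stabilizer := by
    rintro _ ⟨ω₀, hω₀, rfl⟩ B
    refine exists_congr fun ω => and_congr_right fun hω => ?_
    have hωΔ : ω ∈ Δ := by
      obtain ⟨m, hm, rfl⟩ := hω
      exact hΔ.smul_mem m (hMH hm) ω₀ hω₀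
    have hle : MulAction.stabilizer A ω ≤ MulAction.stabilizer A (subgroupOrbit M ω₀) := by
      intro a ha
      rw [MulAction.mem_stabilizer_iff] at ha ⊢
      rw [← subgroupOrbit_eq_of_mem hω, hΔ.act_subgroupOrbit hinv, ha]
    rw [← hP.inf_stabilizer ω hωΔ, inf_assoc, inf_eq_right.2 hle, hP.inf_stabilizer ω hωΔ]
  smul := by
    rintro _ ⟨ω₀, hω₀, rfl⟩ B c hc ⟨ω, hω, hPω⟩
    have hωΔ : ω ∈ Δ := by
      obtain ⟨m, hm, rfl⟩ := hω
      exact hΔ.smul_mem m (hMH hm) ω₀ hω₀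
    exact ⟨c • ω, Set.smul_mem_smul_set hω, hP.smul ω hωΔ B c hc hPω⟩
  not_top := by
    rintro _ ⟨ω₀, hω₀, rfl⟩ ⟨ω, ⟨m, hm, rfl⟩, hPω⟩
    exact hP.not_top _ (hΔ.smul_mem m (hMH hm) ω₀ hω₀) hPω
  exists_of_lt B hB := by
    obtain ⟨ω, hω, hPω⟩ := hP.exists_of_lt B hB
    exact ⟨_, ⟨ω, hω, rfl⟩, ω, mem_subgroupOrbit_self M ω, hPω⟩

/-- Let the nilpotent group `A` act on the solvable group `G`, with a good action and with regular
orbits, and let both act compatibly on an orbit `Δ` of an `A`-invariant subgroup of `G`. If `A` is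
minimally fixed point free on a module graded by `Δ`, then `A` fixes every point of `Δ`. -/
theorem IsStableOrbit.act_eq [Finite G] [Group.IsSolvable G] [Group.IsNilpotent A]
    (hgood : IsGood φ) (hreg : HasRegularOrbits φ) (hΔ : IsStableOrbit φ H Δ)
    (hP : IsMinimallyFixedPointFree φ H Δ P) : ∀ a : A, ∀ ω ∈ Δ, a • ω = ω := by
  -- The type `Ω` is generalized because the induction also applies to block systems, which live in
  -- `Set Ω`.
  suffices key : ∀ (n : ℕ) (Ω : Type w) [MulAction G Ω] [MulAction A Ω] (H : Subgroup G)
      (Δ : Set Ω) (P : Ω → Subgroup A → Prop), Δ.ncard + Nat.card H = n →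
      IsStableOrbit φ H Δ → IsMinimallyFixedPointFree φ H Δ P → ∀ a : A, ∀ ω ∈ Δ, a • ω = ω from
    key _ Ω H Δ P rfl hΔ hP
  clear hΔ hP
  intro n
  induction n using Nat.strong_induction_on with
  | _ n ih =>
  intro Ω _ _ H Δ P hn hΔ hP
  rcases Δ.eq_empty_or_nonempty with rfl | ⟨ω₀, hω₀⟩
  · exact fun a ω hω => absurd hω (Set.notMem_empty ω)
  have hfin : Δ.Finite := by
    refine (Set.finite_range fun g : G => g • ω₀).subset fun ω hω => ?_
    obtain ⟨h, -, rfl⟩ := hΔ.trans ω₀ hω₀ ω hω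
    exact ⟨h, rfl⟩
  by_cases hH : H ≤ actionKernel H Δ
  · intro a ω hω
    obtain ⟨h, hh, e⟩ := hΔ.trans ω hω _ (hΔ.act_mem a ω hω)
    rw [← e, (hH hh).2 ω hω]
  obtain ⟨M, ⟨hMinv, hMH, hMn, hML⟩, hmin⟩ := exists_minimal_of_wellFoundedLT
    (fun M : Subgroup G => (∀ a : A, ∀ m ∈ M, φ a m ∈ M) ∧ M ≤ H ∧
      (∀ h ∈ H, ∀ m ∈ M, h * m * h⁻¹ ∈ M) ∧ ¬ M ≤ actionKernel H Δ)
    ⟨H, hΔ.invariant, le_rfl, fun h hh m hm => H.mul_mem (H.mul_mem hh hm) (H.inv_mem hh), hH⟩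
  by_cases htrans : ∀ ω ∈ Δ, ∀ ω' ∈ Δ, ∃ m ∈ M, m • ω = ω'
  · rcases hMH.lt_or_eq with hlt | rfl
    · refine ih _ ?_ Ω M Δ P rfl ⟨hΔ.compat, hMinv, fun h hh => hΔ.smul_mem h (hMH hh),
        hΔ.act_mem, htrans⟩ ⟨hP.inf_stabilizer, fun ω hω B c hc =>
          hP.smul ω hω B c ⟨hMH hc.1, hc.2⟩, hP.not_top, hP.exists_of_lt⟩
      rw [← hn]
      have := Set.ncard_lt_ncard (SetLike.coe_ssubset_coe.2 hlt) (Set.toFinite _)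
      exact Nat.add_lt_add_left this _
    -- Now `M = H`. By minimality the proper subgroup `⁅M, M⁆` acts trivially on `Δ`. So `M` is
    -- abelian modulo the kernel; any `J` in between is then normal in `M`, and minimality gives
    -- irreducibility.
    · have hbot : M ≠ ⊥ := by rintro rfl; exact hML bot_le
      have hcl : ⁅M, M⁆ < M := Group.IsSolvable.commutator_lt_of_ne_bot hbot
      have hcomm : ⁅M, M⁆ ≤ actionKernel M Δ := by
        by_contra hnot
        refine hcl.not_ge (hmin ⟨fun a m hm => ?_, hcl.le, fun h hh m hm => ?_, hnot⟩ hcl.le)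
        · have h1 : φ a m ∈ ⁅M, M⁆.map (φ a).toMonoidHom := ⟨m, hm, rfl⟩
          rw [Subgroup.map_commutator] at h1
          refine Subgroup.commutator_mono ?_ ?_ h1 <;>
          · rintro _ ⟨x, hx, rfl⟩; exact hMinv a x hx
        · rw [show h * m * h⁻¹ = ⁅h, m⁆ * m by rw [commutatorElement_def, inv_mul_cancel_right]]
          exact Subgroup.mul_mem _ (Subgroup.commutator_mem_commutator hh (hcl.le hm)) hm
      obtain ⟨ω, hω, hstab⟩ := hΔ.exists_stabilizer_eq_kernel hreg ⟨ω₀, hω₀⟩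
        (fun h hh k hk ω hω => by
          have := (hcomm (Subgroup.commutator_mem_commutator hh hk)).2 (k • h • ω)
            (hΔ.smul_mem k hk _ (hΔ.smul_mem h hh ω hω))
          rw [← this]
          simp only [← mul_smul]
          rw [commutatorElement_def]
          congr 1
          group)
        (fun J hJ hLJ hJM => by
          by_contra hne
          rw [not_or] at hne
          refine hne.2 (le_antisymm hJM (hmin ⟨fun a => hJ a trivial, hJM, fun h hh m hm => ?_,
            fun hle => hne.1 (le_antisymm hle hLJ)⟩ hJM))
          rw [show h * m * h⁻¹ = ⁅h, m⁆ * m by rw [commutatorElement_def, inv_mul_cancel_right]]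
          exact J.mul_mem (hLJ (hcomm (Subgroup.commutator_mem_commutator hh (hJM hm)))) hm)
        hH
      exact hP.act_eq_of_stabilizer_eq_kernel hΔ hgood hω hstab
  -- The `M`-orbits are blocks, fewer than the points because `M` moves some point. So `A` fixes
  -- each block, and it remains to treat `M` on a single block.
  · have hblock := ih _ (by
      rw [← hn]
      refine Nat.add_lt_add_right (lt_of_le_of_ne (Set.ncard_image_le hfin) fun hcard => hML ?_) _
      have hinj := Set.injOn_of_ncard_image_eq hcard hfin
      refine fun m hm => ⟨hMH hm, fun ω hω => ?_⟩
      exact hinj (hΔ.smul_mem m (hMH hm) ω hω) hω (subgroupOrbit_eq_of_mem ⟨m, hm, rfl⟩))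
      (Set Ω) H _ _ rfl (hΔ.image_subgroupOrbit hMinv hMn) (hP.image_subgroupOrbit hΔ hMH hMinv)
    intro a ω hω
    have hsub : subgroupOrbit M ω ⊆ Δ := by
      rintro _ ⟨m, hm, rfl⟩
      exact hΔ.smul_mem m (hMH hm) ω hω
    have hact (a : A) : subgroupOrbit M (a • ω) = subgroupOrbit M ω := by
      rw [← hΔ.act_subgroupOrbit hMinv, hblock a _ ⟨ω, hω, rfl⟩]
    refine ih _ ?_ Ω M (subgroupOrbit M ω) P rfl ⟨hΔ.compat, hMinv, ?_, ?_, ?_⟩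
      ⟨fun x hx => hP.inf_stabilizer x (hsub hx), fun x hx B c hc =>
        hP.smul x (hsub hx) B c ⟨hMH hc.1, hc.2⟩, fun x hx => hP.not_top x (hsub hx), ?_⟩ a ω
      (mem_subgroupOrbit_self M ω)
    · rw [← hn]
      refine Nat.add_lt_add_of_lt_of_le (Set.ncard_lt_ncard (hsub.ssubset_of_ne fun heq => ?_) hfin)
        (Set.ncard_le_ncard hMH (Set.toFinite _))
      refine htrans fun x hx y hy => ?_
      rw [← heq] at hx hy
      rw [← subgroupOrbit_eq_of_mem hx] at hy
      exact hy
    · rintro m hm _ ⟨k, hk, rfl⟩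
      exact ⟨m * k, M.mul_mem hm hk, mul_smul m k ω⟩
    · intro b x hx
      rw [← hact b, ← hΔ.act_subgroupOrbit hMinv]
      exact Set.smul_mem_smul_set hx
    · intro x hx y hy
      rw [← subgroupOrbit_eq_of_mem hx] at hy
      exact hy
    · intro B hB
      obtain ⟨x, hx, hPx⟩ := hP.exists_of_lt B hB
      -- `C_H(A)` is transitive on the blocks, so the witness `x` can be moved into the block of `ω`
      -- by an element fixed by `A`, in particular by `B`.
      obtain ⟨c, hc, hcx⟩ := (hΔ.image_subgroupOrbit hMinv hMn).exists_fixed_smul_eq hgood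
        (B := ⊤) (fun b _ => hblock b) ⟨x, hx, rfl⟩ ⟨ω, hω, rfl⟩
      refine ⟨c • x, ?_, hP.smul x hx B c ⟨hc.1, fun b _ => hc.2 b trivial⟩ hPx⟩
      rw [← hcx]
      exact Set.smul_mem_smul_set (mem_subgroupOrbit_self M x)

end Orbits

/-! ### Homogeneous components as minimal fully invariant subspaces -/

section FullyInvariant

variable {Γ V : Type*} [Group Γ] [AddCommGroup V] [Module ℂ V]

/-- The subspace `W` is stable under `Γ` and under all `Γ`-endomorphisms of the module. -/
structure IsFullyInvariant (σ : Representation ℂ Γ V) (W : Submodule ℂ V) : Prop where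
  apply_mem : ∀ g, ∀ w ∈ W, σ g w ∈ W
  end_mem : ∀ f : V →ₗ[ℂ] V, (∀ g v, f (σ g v) = σ g (f v)) → ∀ w ∈ W, f w ∈ W

variable {σ : Representation ℂ Γ V}

theorem isFullyInvariant_iff (U : Subrepresentation σ) :
    IsFullyInvariant σ U.toSubmodule ↔ U.asSubmodule.IsFullyInvariant := by
  constructor
  · intro h f w hw
    let F := (Representation.IntertwiningMap.equivLinearMapAsModule σ σ).symm f
    exact h.end_mem F.toLinearMap (fun g v => F.isIntertwining σ σ g v) w hw
  · refine fun h => ⟨U.apply_mem_toSubmodule, fun f hf w hw => ?_⟩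
    exact h (Representation.IntertwiningMap.equivLinearMapAsModule σ σ
      (f.intertwiningMap_of_isIntertwiningMap σ σ hf)) hw

/-- A fully invariant subspace, as a subrepresentation. -/
def IsFullyInvariant.toSubrepresentation {W : Submodule ℂ V} (h : IsFullyInvariant σ W) :
    Subrepresentation σ :=
  ⟨W, h.apply_mem⟩

theorem asSubmodule_eq_bot_iff (U : Subrepresentation σ) :
    U.asSubmodule = ⊥ ↔ U.toSubmodule = ⊥ := by
  rw [Submodule.eq_bot_iff, Submodule.eq_bot_iff]; rfl

theorem asSubmodule_eq_top_iff (U : Subrepresentation σ) :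
    U.asSubmodule = ⊤ ↔ U.toSubmodule = ⊤ := by
  rw [Submodule.eq_top_iff', Submodule.eq_top_iff']; rfl

theorem sSupIndep_homogeneousComponents (σ : Representation ℂ Γ V) :
    sSupIndep {W | IsHomogeneousComponent σ W} := by
  rintro _ ⟨U, rfl, hU⟩
  have hdisj := sSupIndep_isotypicComponents ℂ[Γ] σ.asModule hU
  rw [Submodule.disjoint_def] at hdisj ⊢
  refine fun x hx hx' => hdisj x hx ?_
  refine (sSup_le ?_ : _ ≤ (Subrepresentation.ofSubmodule'
    (sSup (isotypicComponents ℂ[Γ] σ.asModule \ {U.asSubmodule}))).toSubmodule) hx'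
  rintro _ ⟨⟨U', rfl, hU'⟩, hne⟩ y hy
  have hmem : U'.asSubmodule ∈ isotypicComponents ℂ[Γ] σ.asModule \ {U.asSubmodule} :=
    ⟨hU', fun h => hne (congrArg Subrepresentation.toSubmodule
      (Subrepresentation.subrepresentationSubmoduleOrderIso.injective h))⟩
  exact le_sSup hmem hy

variable [Finite Γ]

instance : IsSemisimpleModule ℂ[Γ] σ.asModule :=
  haveI : NeZero (Nat.card Γ : ℂ) := ⟨Nat.cast_ne_zero.2 Nat.card_pos.ne'⟩
  (Representation.isSemisimpleRepresentation_iff_isSemisimpleModule_asModule σ).1 inferInstance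

theorem IsHomogeneous.eq_bot_or_eq_top (h : IsHomogeneous σ) {W : Submodule ℂ V}
    (hW : IsFullyInvariant σ W) : W = ⊥ ∨ W = ⊤ := by
  have := isIsotypic_iff_isFullyInvariant_imp_bot_or_top.1 h _
    ((isFullyInvariant_iff hW.toSubrepresentation).1 hW)
  rwa [asSubmodule_eq_bot_iff, asSubmodule_eq_top_iff] at this

/-- Homogeneous components are the minimal nonzero fully invariant subspaces. -/
theorem isHomogeneousComponent_iff {W : Submodule ℂ V} :
    IsHomogeneousComponent σ W ↔ IsFullyInvariant σ W ∧ W ≠ ⊥ ∧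
      ∀ W', IsFullyInvariant σ W' → W' ≤ W → W' = ⊥ ∨ W' = W := by
  constructor
  · rintro ⟨U, rfl, hU⟩
    refine ⟨(isFullyInvariant_iff U).2 (.of_mem_isotypicComponents hU), fun h => ?_,
      fun W' hW' hle => ?_⟩
    · exact (bot_lt_isotypicComponents hU).ne' ((asSubmodule_eq_bot_iff U).2 h)
    · have hfi := (isFullyInvariant_iff hW'.toSubrepresentation).1 hW'
      rcases IsSemisimpleModule.eq_bot_or_exists_simple_le hW'.toSubrepresentation.asSubmodule with
        h | ⟨S, hS, _⟩
      · exact Or.inl ((asSubmodule_eq_bot_iff _).1 h)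
      · have h1 := isFullyInvariant_iff_le_imp_isotypicComponent_le.1 hfi S hS
        have hle' : hW'.toSubrepresentation.asSubmodule ≤ U.asSubmodule := fun x hx => hle hx
        rw [← eq_isotypicComponent_of_le hU (hS.trans hle')] at h1
        exact Or.inr (le_antisymm hle fun x hx => h1 hx)
  · rintro ⟨hW, hne, hmin⟩
    have hfi := (isFullyInvariant_iff hW.toSubrepresentation).1 hW
    obtain ⟨S, hS, hsimple⟩ := (IsSemisimpleModule.eq_bot_or_exists_simple_le
      hW.toSubrepresentation.asSubmodule).resolve_left
      fun h => hne ((asSubmodule_eq_bot_iff _).1 h)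
    have h1 := isFullyInvariant_iff_le_imp_isotypicComponent_le.1 hfi S hS
    let U : Subrepresentation σ :=
      Subrepresentation.ofSubmodule' (isotypicComponent ℂ[Γ] σ.asModule S)
    have hU : U.asSubmodule = isotypicComponent ℂ[Γ] σ.asModule S := rfl
    refine ⟨U, (hmin U.toSubmodule ((isFullyInvariant_iff U).2 ?_) fun x hx => h1 hx).resolve_left
      fun h => ?_, S, hsimple, hU⟩
    · rw [hU]; exact .isotypicComponent _ _ _
    · exact (bot_lt_isotypicComponent S).ne' ((asSubmodule_eq_bot_iff U).2 h)

variable (σ)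

theorem sSup_homogeneousComponents : sSup {W | IsHomogeneousComponent σ W} = ⊤ := by
  let U : Subrepresentation σ := ⟨sSup {W | IsHomogeneousComponent σ W}, fun g => by
    refine (sSup_le fun W hW => ?_ :
      sSup {W | IsHomogeneousComponent σ W} ≤ (sSup {W | IsHomogeneousComponent σ W}).comap (σ g))
    intro w hw
    exact (le_sSup hW : W ≤ _) ((isHomogeneousComponent_iff.1 hW).1.apply_mem g w hw)⟩
  refine (asSubmodule_eq_top_iff U).1 (top_le_iff.1 ?_)
  rw [← sSup_isotypicComponents]
  refine sSup_le fun c hc x hx => ?_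
  have hmem : (Subrepresentation.ofSubmodule' c).toSubmodule ∈ {W | IsHomogeneousComponent σ W} :=
    ⟨Subrepresentation.ofSubmodule' c, rfl, hc⟩
  exact le_sSup hmem hx

end FullyInvariant

/-! ### Clifford theory -/

section Clifford

variable {Γ V : Type*} [Group Γ] [AddCommGroup V] [Module ℂ V]

/-- The action of a group on the subspaces of a module. -/
@[reducible]
def subspaceAction (σ : Representation ℂ Γ V) : MulAction Γ (Submodule ℂ V) where
  smul g W := W.map (σ g)
  one_smul W := by
    change W.map (σ 1) = W
    rw [map_one, Module.End.one_eq_id, Submodule.map_id]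
  mul_smul x y W := by
    change W.map (σ (x * y)) = (W.map (σ y)).map (σ x)
    rw [map_mul, Module.End.mul_eq_comp, Submodule.map_comp]

theorem map_mul_apply (ρ : Representation ℂ Γ V) (x y : Γ) (W : Submodule ℂ V) :
    W.map (ρ (x * y)) = (W.map (ρ y)).map (ρ x) :=
  letI := subspaceAction ρ; mul_smul x y W

theorem map_inv_map (ρ : Representation ℂ Γ V) (x : Γ) (W : Submodule ℂ V) :
    (W.map (ρ x)).map (ρ x⁻¹) = W :=
  letI := subspaceAction ρ; inv_smul_smul x W

theorem map_map_inv (ρ : Representation ℂ Γ V) (x : Γ) (W : Submodule ℂ V) :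
    (W.map (ρ x⁻¹)).map (ρ x) = W :=
  letI := subspaceAction ρ; smul_inv_smul x W

variable {ρ : Representation ℂ Γ V} {N : Subgroup Γ} [hN : N.Normal] {W : Submodule ℂ V}

/-- As `N` is normal, conjugation by `ρ x` preserves both the image of `N` and the algebra of
endomorphisms commuting with it. -/
theorem IsFullyInvariant.map (h : IsFullyInvariant (ρ.comp N.subtype) W) (x : Γ) :
    IsFullyInvariant (ρ.comp N.subtype) (W.map (ρ x)) where
  apply_mem n := by
    rintro _ ⟨w, hw, rfl⟩
    have hn : x⁻¹ * n * x ∈ N := by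
      simpa using hN.conj_mem n n.2 x⁻¹
    refine ⟨_, h.apply_mem ⟨_, hn⟩ w hw, ?_⟩
    change ρ x (ρ (x⁻¹ * n * x) w) = ρ n (ρ x w)
    simp only [← Module.End.mul_apply, ← map_mul]
    congr 2
    group
  end_mem f hf := by
    rintro _ ⟨w, hw, rfl⟩
    refine ⟨_, h.end_mem (ρ x⁻¹ ∘ₗ f ∘ₗ ρ x) (fun n v => ?_) w hw, ?_⟩
    · have hn : x * n * x⁻¹ ∈ N := hN.conj_mem n n.2 x
      have h1 : ρ x (ρ n v) = ρ (x * n * x⁻¹) (ρ x v) := by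
        simp only [← Module.End.mul_apply, ← map_mul]
        congr 2
        group
      have h2 : f (ρ (x * n * x⁻¹) (ρ x v)) = ρ (x * n * x⁻¹) (f (ρ x v)) := hf ⟨_, hn⟩ _
      change ρ x⁻¹ (f (ρ x (ρ n v))) = ρ n (ρ x⁻¹ (f (ρ x v)))
      rw [h1, h2]
      generalize f (ρ x v) = u
      simp only [← Module.End.mul_apply, ← map_mul]
      congr 2
      group
    · change ρ x (ρ x⁻¹ (f (ρ x w))) = f (ρ x w)
      rw [Representation.self_inv_apply]

/-- Translation by `x` is an automorphism of the lattice of fully invariant subspaces, so it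
permutes the minimal nonzero ones. -/
theorem IsHomogeneousComponent.map [Finite Γ] (h : IsHomogeneousComponent (ρ.comp N.subtype) W)
    (x : Γ) : IsHomogeneousComponent (ρ.comp N.subtype) (W.map (ρ x)) := by
  rw [isHomogeneousComponent_iff] at h ⊢
  refine ⟨h.1.map x, fun hbot => h.2.1 ?_, fun W' hW' hle => ?_⟩
  · rw [← map_inv_map ρ x W, hbot, Submodule.map_bot]
  · have h1 : W'.map (ρ x⁻¹) ≤ W := (Submodule.map_mono hle).trans (map_inv_map ρ x W).le
    rw [← map_map_inv ρ x W']
    refine (h.2.2 _ (hW'.map x⁻¹) h1).imp (fun e => ?_) fun e => ?_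
    · rw [e, Submodule.map_bot]
    · rw [e]

/-- **Clifford's theorem**: if the restriction of a module to a subgroup containing the normal
subgroup `N` is homogeneous, then that subgroup permutes the homogeneous components of `N`
transitively. -/
theorem IsHomogeneous.exists_map_eq [Finite Γ] {K : Type*} [Group K] [Finite K] {ι : K →* Γ}
    (hhom : IsHomogeneous (ρ.comp ι)) (hNK : N ≤ ι.range) {W W' : Submodule ℂ V}
    (hW : IsHomogeneousComponent (ρ.comp N.subtype) W)
    (hW' : IsHomogeneousComponent (ρ.comp N.subtype) W') :
    ∃ g : K, W.map (ρ (ι g)) = W' := by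
  by_contra! hne
  -- Endomorphisms commuting with `K` commute with `N`, so they preserve each translate of `W`. By
  -- homogeneity the sum of the translates is all of `V`, which leaves no room for an independent
  -- `W'`.
  have hfi : IsFullyInvariant (ρ.comp ι) (⨆ g : K, W.map (ρ (ι g))) := by
    constructor
    · intro g
      suffices h : (⨆ k : K, W.map (ρ (ι k))) ≤
          (⨆ k : K, W.map (ρ (ι k))).comap (ρ (ι g)) from fun w hw => h hw
      refine iSup_le fun k => ?_
      rw [← Submodule.map_le_iff_le_comap, ← map_mul_apply, ← map_mul]
      exact le_iSup (fun k => W.map (ρ (ι k))) (g * k)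
    · intro f hf
      suffices h : (⨆ k : K, W.map (ρ (ι k))) ≤ (⨆ k : K, W.map (ρ (ι k))).comap f from
        fun w hw => h hw
      refine iSup_le fun k => ?_
      intro w hw
      refine le_iSup (fun k => W.map (ρ (ι k))) k ?_
      refine (isHomogeneousComponent_iff.1 (hW.map (ι k))).1.end_mem f (fun n v => ?_) w hw
      obtain ⟨g, hg⟩ := hNK n.2
      have := hf g v
      change f (ρ (ι g) v) = ρ (ι g) (f v) at this
      rwa [hg] at this
  have hdisj := sSupIndep_homogeneousComponents _ hW'
  have hle : (⨆ g : K, W.map (ρ (ι g))) ≤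
      sSup ({W | IsHomogeneousComponent (ρ.comp N.subtype) W} \ {W'}) :=
    iSup_le fun g => le_sSup ⟨hW.map (ι g), hne g⟩
  rcases hhom.eq_bot_or_eq_top hfi with h | h
  · refine (isHomogeneousComponent_iff.1 (hW.map (ι 1))).2.1 (le_bot_iff.1 (h ▸ ?_))
    exact le_iSup (fun g => W.map (ρ (ι g))) 1
  · rw [h, top_le_iff] at hle
    rw [hle, disjoint_top] at hdisj
    exact (isHomogeneousComponent_iff.1 hW').2.1 hdisj

end Clifford

/-! ### Fixed points in a graded module, and the conclusion -/

variable {G A V : Type*} [Group G] [Finite G] [Group A] [Finite A] [AddCommGroup V] [Module ℂ V]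
  {φ : A →* MulAut G}

/-- The subgroup of `B` stabilizing `W` has a nonzero fixed point in `W`. -/
def HasFixedPoint (σ : Representation ℂ A V) (W : Submodule ℂ V) (B : Subgroup A) : Prop :=
  ∃ v ∈ W, v ≠ 0 ∧ ∀ b ∈ B, W.map (σ b) = W → σ b v = v

/-- The sum of the `A`-translates of `v` is `A`-fixed, hence zero, while its component in `W` is `v`
times the order of the stabilizer of `W`. -/
theorem not_hasFixedPoint_top {σ : Representation ℂ A V} {Δ : Set (Submodule ℂ V)}
    (hind : sSupIndep Δ) (hfix : σ.invariants = ⊥) {W : Submodule ℂ V} (hW : W ∈ Δ)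
    (hmem : ∀ a, W.map (σ a) ∈ Δ) : ¬ HasFixedPoint σ W ⊤ := by
  classical
  rintro ⟨v, hv, hv0, hfixed⟩
  have := Fintype.ofFinite A
  have hsum : ∑ a, σ a v = 0 := by
    rw [← Submodule.mem_bot ℂ, ← hfix, Representation.mem_invariants]
    intro b
    rw [map_sum]
    refine Fintype.sum_equiv (Equiv.mulLeft b) _ _ fun a => ?_
    rw [Equiv.coe_mulLeft, map_mul, Module.End.mul_apply]
  rw [← Finset.sum_filter_add_sum_filter_not Finset.univ (fun a => W.map (σ a) = W)] at hsum
  have h1 : ∑ a with W.map (σ a) = W, σ a v =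
      ((Finset.univ.filter fun a => W.map (σ a) = W).card : ℂ) • v := by
    rw [Finset.sum_congr rfl fun a ha => hfixed a trivial (Finset.mem_filter.1 ha).2,
      Finset.sum_const, Nat.cast_smul_eq_nsmul]
  have h2 : ∑ a with ¬ W.map (σ a) = W, σ a v ∈ sSup (Δ \ {W}) := by
    refine Submodule.sum_mem _ fun a ha => ?_
    have hle : W.map (σ a) ≤ sSup (Δ \ {W}) := le_sSup ⟨hmem a, (Finset.mem_filter.1 ha).2⟩
    exact hle (Submodule.mem_map_of_mem hv)
  rw [h1] at hsum
  have h3 := Submodule.disjoint_def.1 (hind hW) _ (Submodule.smul_mem W _ hv)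
    (by rw [eq_neg_of_add_eq_zero_left hsum]; exact Submodule.neg_mem _ h2)
  have hcard : (Finset.univ.filter fun a => W.map (σ a) = W).card ≠ 0 :=
    Finset.card_ne_zero_of_mem (a := 1) (Finset.mem_filter.2 ⟨Finset.mem_univ _, by
      rw [map_one, Module.End.one_eq_id, Submodule.map_id]⟩)
  exact hv0 ((smul_eq_zero.1 h3).resolve_left (Nat.cast_ne_zero.2 hcard))

/-- If the sum over the stabilizer in `B` killed every vector of every `W`, the sum `e` over all of
`B` would kill `V`, as `e` absorbs translates. But `e` multiplies a `B`-fixed vector by the order of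
`B`. -/
theorem exists_hasFixedPoint {σ : Representation ℂ A V} {Δ : Set (Submodule ℂ V)}
    (htop : sSup Δ = ⊤) {B : Subgroup A}
    (hB : Representation.invariants (σ.comp B.subtype) ≠ ⊥) : ∃ W ∈ Δ, HasFixedPoint σ W B := by
  classical
  by_contra! hne
  have := Fintype.ofFinite B
  obtain ⟨v, hv, hv0⟩ := Submodule.exists_mem_ne_zero_of_ne_bot hB
  have hv : ∀ b : B, σ b v = v := (Representation.mem_invariants _ v).1 hv
  let e : V →ₗ[ℂ] V := ∑ b : B, σ b
  have he (w : V) : e w = ∑ b : B, σ b w := LinearMap.sum_apply _ _ _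
  have hker : sSup Δ ≤ LinearMap.ker e := by
    refine sSup_le fun W hW w hw => ?_
    let s : Finset B := Finset.univ.filter fun b => W.map (σ b) = W
    have hs (b : B) : b ∈ s ↔ W.map (σ b) = W := by simp [s]
    have hu : ∑ b ∈ s, σ b w = 0 := by
      by_contra hu
      refine hne W hW ⟨_, Submodule.sum_mem _ fun b hb => ?_, hu, fun b hb hbW => ?_⟩
      · exact ((hs b).1 hb).le (Submodule.mem_map_of_mem hw)
      · rw [map_sum]
        refine Finset.sum_equiv (Equiv.mulLeft (⟨b, hb⟩ : B)) (fun c => ?_) fun c _ => ?_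
        · rw [hs, hs, Equiv.coe_mulLeft, Subgroup.coe_mul, map_mul_apply]
          constructor
          · intro h; rw [h, hbW]
          · intro h
            refine Submodule.map_injective_of_injective (f := σ b) (σ.apply_bijective b).1 ?_
            rw [hbW, h]
        · rw [Equiv.coe_mulLeft, Subgroup.coe_mul, map_mul, Module.End.mul_apply]
    have hmul (c : B) : e (σ c w) = e w := by
      rw [he, he]
      refine Fintype.sum_equiv (Equiv.mulRight c) _ _ fun b => ?_
      rw [Equiv.coe_mulRight, Subgroup.coe_mul, map_mul, Module.End.mul_apply]
    have h1 : e (∑ b ∈ s, σ b w) = (s.card : ℂ) • e w := by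
      rw [map_sum, Finset.sum_congr rfl fun c _ => hmul c, Finset.sum_const,
        Nat.cast_smul_eq_nsmul]
    rw [hu, map_zero] at h1
    have hcard : s.card ≠ 0 := Finset.card_ne_zero_of_mem (a := 1) <| by
      rw [hs, Subgroup.coe_one, map_one, Module.End.one_eq_id, Submodule.map_id]
    exact (smul_eq_zero.1 h1.symm).resolve_left (Nat.cast_ne_zero.2 hcard)
  have hev : e v = 0 := hker (htop ▸ Submodule.mem_top)
  rw [he, Finset.sum_congr rfl fun b _ => hv b, Finset.sum_const, Finset.card_univ,
    ← Nat.cast_smul_eq_nsmul ℂ] at hev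
  exact hv0 ((smul_eq_zero.1 hev).resolve_left (Nat.cast_ne_zero.2 Fintype.card_ne_zero))

/-- Let the nilpotent group `A` act on the solvable group `G`, with a good action and with regular
orbits, and let `V` be a `GA`-module with `V_G` homogeneous, `C_V(A) = 0` and `C_V(A₀) ≠ 0` for
every `A₀ < A`. Then `A` stabilizes every homogeneous component of `V_N`, for every normal subgroup
`N ≤ G` of `GA`, and `C_G(A)` permutes these components transitively. No assumption on the center
of `N` is needed; since `Z(N)` acts by scalars on each component, the conclusion implies that
`[Z(N), A]` acts trivially on `V`. -/
theorem homogeneousComponent_stabilizer [Group.IsSolvable G] [Group.IsNilpotent A]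
    (hreg : HasRegularOrbits φ) (hgood : IsGood φ) (ρ : Representation ℂ (G ⋊[φ] A) V)
    (hhom : IsHomogeneous (ρ.comp SemidirectProduct.inl))
    (hfix : (Representation.invariants (ρ.comp SemidirectProduct.inr)) = ⊥)
    (hproper : ∀ A₀ : Subgroup A, A₀ < ⊤ →
      Representation.invariants (ρ.comp (SemidirectProduct.inr.comp A₀.subtype)) ≠ ⊥)
    (N : Subgroup (G ⋊[φ] A)) [N.Normal]
    (hNG : N ≤ (SemidirectProduct.inl : G →* G ⋊[φ] A).range)
    (W : Submodule ℂ V) (hW : IsHomogeneousComponent (ρ.comp N.subtype) W) :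
    (∀ a : A, W.map (ρ (SemidirectProduct.inr a)) = W) ∧
    commSubgroup φ ⊤ ⊤ ≤ stabilizer (ρ.comp SemidirectProduct.inl) W ∧
    (Set.univ : Set G) =
      (stabilizer (ρ.comp SemidirectProduct.inl) W : Set G) * (fixedSubgroup φ ⊤ ⊤ : Set G) := by
  have : Finite (G ⋊[φ] A) := Finite.of_equiv _ SemidirectProduct.equivProd.symm
  let _ : MulAction G (Submodule ℂ V) := subspaceAction (ρ.comp SemidirectProduct.inl)
  let _ : MulAction A (Submodule ℂ V) := subspaceAction (ρ.comp SemidirectProduct.inr)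
  have compat (a : A) (g : G) (W : Submodule ℂ V) : a • g • W = φ a g • a • W := by
    change (W.map (ρ (.inl g))).map (ρ (.inr a)) = (W.map (ρ (.inr a))).map (ρ (.inl (φ a g)))
    rw [← map_mul_apply, ← map_mul_apply, SemidirectProduct.inl_aut, map_inv, inv_mul_cancel_right]
  have hΔ : IsStableOrbit φ ⊤ {W | IsHomogeneousComponent (ρ.comp N.subtype) W} :=
    { compat := compat
      invariant := fun _ _ _ => Subgroup.mem_top _
      smul_mem := fun g _ W hW => IsHomogeneousComponent.map hW (.inl g)
      act_mem := fun a W hW => IsHomogeneousComponent.map hW (.inr a)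
      trans := fun W hW W' hW' => by
        obtain ⟨g, hg⟩ := hhom.exists_map_eq hNG hW hW'
        exact ⟨g, Subgroup.mem_top g, hg⟩ }
  have hP : IsMinimallyFixedPointFree φ ⊤ {W | IsHomogeneousComponent (ρ.comp N.subtype) W}
      (HasFixedPoint (ρ.comp SemidirectProduct.inr)) := by
    refine ⟨fun W _ B => ?_, fun W _ B c hc => ?_, fun W hW => ?_, fun B hB => ?_⟩
    · refine exists_congr fun v => and_congr_right fun _ => and_congr_right fun _ => ?_
      exact ⟨fun h b hb hbW => h b ⟨hb, hbW⟩ hbW, fun h b hb hbW => h b hb.1 hbW⟩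
    · rintro ⟨v, hv, hv0, hfixed⟩
      refine ⟨ρ (.inl c) v, Submodule.mem_map_of_mem hv, fun h => hv0 ?_, fun b hb hbW => ?_⟩
      · exact (ρ.apply_bijective (.inl c)).1 (h.trans (map_zero _).symm)
      -- As `c` commutes with `b`, stabilizing `c • W` is the same as stabilizing `W`, and `ρ (.inl
      -- c)` carries fixed vectors to fixed vectors.
      · have hcb : φ b c = c := hc.2 b hb
        have h1 : b • c • W = c • W := hbW
        rw [compat, hcb] at h1
        have h2 : ρ (.inr b) v = v := hfixed b hb (smul_left_cancel c h1)
        have h3 : (.inr b * .inl c : G ⋊[φ] A) = .inl c * .inr b := by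
          conv_rhs => rw [← hcb, SemidirectProduct.inl_aut, map_inv, inv_mul_cancel_right]
        change ρ (.inr b) (ρ (.inl c) v) = ρ (.inl c) v
        rw [← Module.End.mul_apply, ← map_mul, h3, map_mul, Module.End.mul_apply, h2]
    · exact not_hasFixedPoint_top (sSupIndep_homogeneousComponents _) hfix hW
        fun a => hW.map (.inr a)
    · exact exists_hasFixedPoint (sSup_homogeneousComponents _) (hproper B hB)
  have hA := hΔ.act_eq hgood hreg hP
  refine ⟨fun a => hA a W hW, fun x hx => hΔ.commSubgroup_smul (fun b _ => hA b) x hx W hW, ?_⟩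
  refine (Set.eq_univ_of_forall fun g => ?_).symm
  -- Some `c` in `C_G(A)` sends `g⁻¹ • W` to `W`, so `g * c⁻¹` stabilizes `W`.
  obtain ⟨c, hc, hcW⟩ := hΔ.exists_fixed_smul_eq hgood (B := ⊤) (fun b _ => hA b)
    (hΔ.smul_mem g⁻¹ (Subgroup.mem_top _) W hW) hW
  refine Set.mem_mul.2 ⟨g * c⁻¹, ?_, c, hc, inv_mul_cancel_right g c⟩
  change (g * c⁻¹) • W = W
  rw [mul_smul, ← eq_inv_smul_iff, inv_smul_eq_iff, hcW]

end GoodAction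

theorem theorem3p3 {G A V : Type*} [Group G] [Finite G] [Group.IsSolvable G]
    [Group A] [Finite A] [Group.IsNilpotent A] (φ : A →* MulAut G)
    (hreg : GoodAction.HasRegularOrbits φ) (hgood : GoodAction.IsGood φ)
    [AddCommGroup V] [Module ℂ V] (ρ : Representation ℂ (G ⋊[φ] A) V)
    (hhom : GoodAction.IsHomogeneous (ρ.comp SemidirectProduct.inl))
    (hfix : (Representation.invariants (ρ.comp SemidirectProduct.inr)) = ⊥)
    (hproper : ∀ A₀ : Subgroup A, A₀ < ⊤ →
      Representation.invariants (ρ.comp (SemidirectProduct.inr.comp A₀.subtype)) ≠ ⊥)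
    (N : Subgroup (G ⋊[φ] A)) [N.Normal]
    (hNG : N ≤ (SemidirectProduct.inl : G →* G ⋊[φ] A).range)
    (hZ : ∃ z ∈ ⁅(Subgroup.center N).map N.subtype,
        (SemidirectProduct.inr : A →* G ⋊[φ] A).range⁆, ρ z ≠ 1)
    (W : Submodule ℂ V)
    (hW : GoodAction.IsHomogeneousComponent (ρ.comp N.subtype) W) :
    (∀ a : A, W.map (ρ (SemidirectProduct.inr a)) = W) ∧
    GoodAction.commSubgroup φ ⊤ ⊤ ≤
      GoodAction.stabilizer (ρ.comp SemidirectProduct.inl) W ∧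
    (Set.univ : Set G) =
      (GoodAction.stabilizer (ρ.comp SemidirectProduct.inl) W : Set G) *
        (GoodAction.fixedSubgroup φ ⊤ ⊤ : Set G) :=
  GoodAction.homogeneousComponent_stabilizer hreg hgood ρ hhom hfix hproper N hNG W hW
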